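/- Let $d\ge 0$, $m\ge 0$, $E=\{0,\dots,m\}$, and let $F^i:\mathbb{R}^d\to\mathbb{R}^d$, $i\in E$, be bounded $C^\infty$ vector fields with semiflows $\Phi^i(t,x)$, $t\ge 0$. Consider the control system $$\dot x(t)=\sum_{i=0}^m v_i(t)F^i(x(t)),$$ where the controls $v$ are measurable functions on $[0,\infty)$ with values in the unit simplex $\{v\in[0,1]^{m+1}:\sum_i v_i=1\}$, and let $\varphi(t,x,v)$ be its solution with initial value $x$. Let $\mathcal{O}^+_{\le T}(x)=\{\varphi(t,x,v): t\in[0,T],\ v \text{ a control}\}$, $\mathcal{O}^-_{\le T}(x)=\{y: x\in\mathcal{O}^+_{\le T}(y)\}$ and $\mathcal{O}^+(x)=\bigcup_{T>0}\mathcal{O}^+_{\le T}(x)$. A control set is a nonempty set $D\subset\mathbb{R}^d$ that is maximal (for inclusion) with the properties that (i) for every $x\in D$ there is a control $v$ with $\varphi(t,x,v)\in D$ for all $t\ge0$, and (ii) $D\subset\mathrm{cl}\,\mathcal{O}^+(x)$ for every $x\in D$. A control set $C$ is an invariant control set if $\mathrm{cl}\,C=\mathrm{cl}\,\mathcal{O}^+(x)$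 for all $x\in C$. A set $M\subset\mathbb{R}^d$ is positively invariant if $\varphi(t,x,v)\in M$ for all $x\in M$, all controls $v$ and all $t\ge0$; it is locally accessible if for all $x\in M$, all $T>0$ and all neighborhoods $N$ of $x$ the sets $N\cap\mathrm{int}\,\mathcal{O}^+_{\le T}(x)$ and $N\cap\mathrm{int}\,\mathcal{O}^-_{\le T}(x)$ are nonempty. Let $M\subset\mathbb{R}^d$ be compact and positively invariant. Let $x\mapsto Q(x)=(Q(x,i,j))_{i,j\in E}$ be a continuous map from $\mathbb{R}^d$ to the Markov transition matrices on $E$ such that for every $x$ there is $n_x\in\mathbb{N}$ with $Q^{n_x}(x,i,j)>0$ for all $i,j\in E$, and let $\lambda>0$. Let $(\tilde X_n,\tilde Y_n)_n$ be the Markov chain on $M\times E$ given by $\tilde X_{n+1}=\Phi^{\tilde Y_n}(U_{n+1},\tilde X_n)$ and $\mathbb{P}[\tilde Y_{n+1}=j\mid\tilde X_{n+1},\tilde Y_n=i]=Q(\tilde X_{n+1},i,j)$, where the $U_n$ are independent exponential random variables with parameter $\lambda$ (the times between jumps of a Poisson process with intensity $\lambda$), independent of the initial value. Consider the condition (H)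 there are only finitely many invariant control sets $C_r\subset M$, $r=1,\dots,l$, and for every $r$ one has $C_r=\mathrm{cl}(\mathrm{int}\,C_r)$ and $\mathrm{int}\,C_r\subset\mathcal{O}^+(x)$ for every $x\in C_r$. Then: 1. If $M$ is locally accessible, then (H) holds. 2. If (H) holds, then every invariant probability measure $\mu$ of the chain $(\tilde X_n,\tilde Y_n)_n$ on $M\times E$ satisfies $$\mathrm{supp}\,\mu\subset\bigcup_{r=1}^l C_r\times E.$$ -/

import Mathlib

open Set MeasureTheory ProbabilityTheory Topology
open scoped ContDiff ENNReal

noncomputable section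

namespace PDMP

/-- The state space `ℝ^d` with its Euclidean norm. -/
abbrev Space (d : ℕ) : Type := EuclideanSpace ℝ (Fin d)

variable {d m : ℕ}

/-! ### The control system `ẋ = ∑ i, v i (t) • F i (x)` with controls in the unit simplex -/

/-- Admissible controls: measurable `v` with values in the unit `m`-simplex for `t ≥ 0`
(values at negative times play no role). Every class in `L^∞(ℝ₊, co S)` has such a
representative, and trajectories do not depend on the representative. -/
def IsControl (v : ℝ → Fin (m + 1) → ℝ) : Prop :=
  Measurable v ∧ ∀ t, 0 ≤ t → v t ∈ stdSimplex ℝ (Fin (m + 1))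

/-- `γ` restricted to `[0, ∞)` is the trajectory `φ(·, x, v)`: the absolutely continuous solution,
in integrated form, of `ẋ(t) = ∑ i, v i (t) • F i (x(t))` with initial value `x`. -/
def IsTrajectory (F : Fin (m + 1) → Space d → Space d) (v : ℝ → Fin (m + 1) → ℝ)
    (x : Space d) (γ : ℝ → Space d) : Prop :=
  ContinuousOn γ (Ici 0) ∧
    ∀ t, 0 ≤ t → γ t = x + ∫ s in (0 : ℝ)..t, ∑ i, v s i • F i (γ s)

/-- `φ(t, x, v) ∈ M` for all `x ∈ M`, all controls `v` and all `t ≥ 0`. -/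
def PositivelyInvariant (F : Fin (m + 1) → Space d → Space d) (M : Set (Space d)) : Prop :=
  ∀ x ∈ M, ∀ v γ, IsControl v → IsTrajectory F v x γ → ∀ t, 0 ≤ t → γ t ∈ M

/-- The set of points reachable from `x` up to time `T`. -/
def reachLE (F : Fin (m + 1) → Space d → Space d) (T : ℝ) (x : Space d) : Set (Space d) :=
  {y | ∃ v γ, IsControl v ∧ IsTrajectory F v x γ ∧ ∃ t ∈ Icc 0 T, γ t = y}

/-- The set of points that can be controlled to `x` up to time `T`. -/
def controllableLE (F : Fin (m + 1) → Space d → Space d) (T : ℝ) (x : Space d) :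
    Set (Space d) :=
  {y | x ∈ reachLE F T y}

/-- The reachable set `𝒪⁺(x)`. -/
def reach (F : Fin (m + 1) → Space d → Space d) (x : Space d) : Set (Space d) :=
  ⋃ (T : ℝ) (_ : 0 < T), reachLE F T x

/-- Nonempty, controlled invariant, and approximately controllable: the properties with respect
to which control sets are maximal. -/
structure IsPreControlSet (F : Fin (m + 1) → Space d → Space d) (D : Set (Space d)) : Prop where
  nonempty : D.Nonempty
  controlled_invariant : ∀ x ∈ D, ∃ v γ, IsControl v ∧ IsTrajectory F v x γ ∧
    ∀ t, 0 ≤ t → γ t ∈ D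
  subset_closure_reach : ∀ x ∈ D, D ⊆ closure (reach F x)

/-- Control sets of the system (maximal with respect to set inclusion). -/
def IsControlSet (F : Fin (m + 1) → Space d → Space d) (D : Set (Space d)) : Prop :=
  Maximal (IsPreControlSet F) D

/-- Invariant control sets. -/
def IsInvariantControlSet (F : Fin (m + 1) → Space d → Space d) (C : Set (Space d)) : Prop :=
  IsControlSet F C ∧ ∀ x ∈ C, closure C = closure (reach F x)

/-- Local accessibility at every point of `M`. -/
def LocallyAccessibleOn (F : Fin (m + 1) → Space d → Space d) (M : Set (Space d)) : Prop :=
  ∀ x ∈ M, ∀ T : ℝ, 0 < T → ∀ N ∈ 𝓝 x,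
    (interior (reachLE F T x) ∩ N).Nonempty ∧ (interior (controllableLE F T x) ∩ N).Nonempty

/-- The invariant control sets contained in `M`. -/
def invariantControlSets (F : Fin (m + 1) → Space d → Space d) (M : Set (Space d)) :
    Set (Set (Space d)) :=
  {C | IsInvariantControlSet F C ∧ C ⊆ M}

/-- `M` contains only finitely many invariant control sets, and each of them satisfies
`C = cl (int C)` and `int C ⊆ 𝒪⁺(x)` for every `x ∈ C`. -/
def FinitelyManyRegularInvariantControlSets (F : Fin (m + 1) → Space d → Space d)
    (M : Set (Space d)) : Prop :=
  (invariantControlSets F M).Finite ∧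
    ∀ C ∈ invariantControlSets F M,
      C = closure (interior C) ∧ ∀ x ∈ C, interior C ⊆ reach F x

/-! ### The discrete-time chain -/

/-- The semiflow `Φ(t, x)`, `t ≥ 0`, of the vector field `f`: the value at time `t` of the solution
of `ẋ = f x` on `[0, ∞)` starting at `x`. For bounded smooth `f` this solution exists and is
unique; values at negative `t` are irrelevant. -/
def flow (f : Space d → Space d) (t : ℝ) (x : Space d) : Space d :=
  Classical.epsilon
    (fun γ : ℝ → Space d => γ 0 = x ∧ IsIntegralCurveOn γ (fun _ => f) (Ici 0)) t

/-- One-step transition probability `P((x, i), A)` of the chain `(X_n, Y_n)` given by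
`X_{n+1} = Φ^{Y_n}(U_{n+1}, X_n)` and `ℙ[Y_{n+1} = j | X_{n+1}, Y_n = i] = Q(X_{n+1}, i, j)`, where
the interjump times `U_n` of the Poisson process are independent and exponentially distributed
with rate `lam`. -/
def transitionProb (F : Fin (m + 1) → Space d → Space d)
    (Q : Space d → Matrix (Fin (m + 1)) (Fin (m + 1)) ℝ) (lam : ℝ)
    (z : Space d × Fin (m + 1)) (A : Set (Space d × Fin (m + 1))) : ℝ≥0∞ :=
  ∫⁻ u, ∑ j, ENNReal.ofReal (Q (flow (F z.2) u z.1) z.2 j) *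
    A.indicator 1 (flow (F z.2) u z.1, j) ∂(expMeasure lam)

/-- Invariant probability measures of the chain on `M × E` (as measures on `ℝ^d × E` that are
concentrated on `M × E`). -/
structure IsInvariantMeasure (F : Fin (m + 1) → Space d → Space d)
    (Q : Space d → Matrix (Fin (m + 1)) (Fin (m + 1)) ℝ) (lam : ℝ) (M : Set (Space d))
    (μ : Measure (Space d × Fin (m + 1))) : Prop where
  isProbabilityMeasure : IsProbabilityMeasure μ
  concentrated : μ (M ×ˢ univ)ᶜ = 0
  invariant : ∀ A, MeasurableSet A → μ A = ∫⁻ z, transitionProb F Q lam z A ∂μ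

end PDMP

end

/-!
# Supports of invariant measures of piecewise deterministic Markov processes

Two facts reduce both claims to properties of the semiflows of the single vector fields `F i`.

* A closed set that is invariant under each of the semiflows is invariant under every trajectory of
  the control system (`PDMP.FlowInvariant.positivelyInvariant`). The squared distance of a
  trajectory to such a set satisfies a Grönwall inequality: at a nearest point of the set none of
  the `F i`, and therefore no convex combination of them, points towards the trajectory, and `F i`
  is locally Lipschitz. This bypasses
  both solving the equation for measurable controls and approximating such controls by piecewise
  constant ones.
* A nonempty compact flow-invariant set contains an invariant control set, namely a minimal closed
  flow-invariant subset (`PDMP.exists_isInvariantControlSet_subset`).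

Under local accessibility, reachable sets have interior points near their starting point. This makes
an invariant control set `C` closed, so that it contains the reachable sets of its points, and
gives `C = cl (int C)`; the corresponding property of controllable sets yields `int C ⊆ 𝒪⁺(x)`.
If there were infinitely many invariant control sets in `M`, the points near which infinitely many
of them occur would form a nonempty compact flow-invariant set, which would contain an invariant
control set with interior points. This is impossible as invariant control sets are disjoint.

For an invariant measure `μ` of the chain, let `A` be the union of the sets `C × E`, which is
absorbing. As `μ A` does not change in one step, the support `N` of the restriction of `μ` to the
complement of `A` is closed under all steps that are possible for the chain
(`PDMP.IsInvariantMeasure.notMem_support_restrict_compl`). Irreducibility of `Q x` makes `N` a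
product `S × E`, and `S` is closed and flow-invariant. If it were nonempty, `S` would contain one of
the sets `C`, while `int C × E` is not charged by the restricted measure. Hence `μ` is concentrated
on the closed set `A`.
-/

namespace PDMP

open Metric
open scoped NNReal

variable {d m : ℕ} {F : Fin (m + 1) → Space d → Space d}
  {Q : Space d → Matrix (Fin (m + 1)) (Fin (m + 1)) ℝ} {lam : ℝ}

/-! ### The semiflow of a bounded smooth vector field -/

lemma exists_lipschitzOnWith_closedBall {f : Space d → Space d} (hf : ContDiff ℝ ∞ f)
    (x : Space d) (R : ℝ) : ∃ L : ℝ≥0, LipschitzOnWith L f (closedBall x R) :=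
  LocallyLipschitzOn.exists_lipschitzOnWith_of_compact (isCompact_closedBall x R)
    ((hf.of_le (by simp)).locallyLipschitz.locallyLipschitzOn)

lemma eqOn_Icc_of_isIntegralCurveOn {f : Space d → Space d} (hf : ContDiff ℝ ∞ f) {T : ℝ}
    {γ₁ γ₂ : ℝ → Space d} (h₁ : IsIntegralCurveOn γ₁ (fun _ => f) (Icc 0 T))
    (h₂ : IsIntegralCurveOn γ₂ (fun _ => f) (Icc 0 T)) (h0 : γ₁ 0 = γ₂ 0) :
    EqOn γ₁ γ₂ (Icc 0 T) := by
  have c₁ : ContinuousOn γ₁ (Icc 0 T) := HasDerivWithinAt.continuousOn h₁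
  have c₂ : ContinuousOn γ₂ (Icc 0 T) := HasDerivWithinAt.continuousOn h₂
  obtain ⟨R₁, hR₁⟩ := (isCompact_Icc.image_of_continuousOn c₁).isBounded.subset_closedBall 0
  obtain ⟨R₂, hR₂⟩ := (isCompact_Icc.image_of_continuousOn c₂).isBounded.subset_closedBall 0
  obtain ⟨L, hL⟩ := exists_lipschitzOnWith_closedBall hf 0 (max R₁ R₂)
  have right : ∀ {γ : ℝ → Space d}, IsIntegralCurveOn γ (fun _ => f) (Icc 0 T) →
      ∀ t ∈ Ico 0 T, HasDerivWithinAt γ (f (γ t)) (Ici t) t := fun h t ht =>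
    (h t (Ico_subset_Icc_self ht)).mono_of_mem_nhdsWithin
      (Filter.mem_of_superset (Icc_mem_nhdsGE ht.2) (Icc_subset_Icc_left ht.1))
  refine ODE_solution_unique_of_mem_Icc_right (v := fun _ => f) (K := L)
    (s := fun _ => closedBall 0 (max R₁ R₂)) (fun _ _ => hL) c₁ (right h₁) ?_ c₂ (right h₂) ?_ h0
  · exact fun t ht => closedBall_subset_closedBall (le_max_left _ _)
      (hR₁ (mem_image_of_mem _ (Ico_subset_Icc_self ht)))
  · exact fun t ht => closedBall_subset_closedBall (le_max_right _ _)
      (hR₂ (mem_image_of_mem _ (Ico_subset_Icc_self ht)))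

/-- Since the vector field is bounded, the Picard–Lindelöf theorem applies on a ball large enough
to give a continuous local flow on any prescribed time interval. -/
lemma exists_local_flow {f : Space d → Space d} (hf : ContDiff ℝ ∞ f)
    (hb : ∃ K : ℝ, ∀ x, ‖f x‖ ≤ K) (x₀ : Space d) {T : ℝ} (hT : 0 ≤ T) :
    ∃ α : Space d × ℝ → Space d, (∀ x ∈ closedBall x₀ 1, α (x, 0) = x ∧
      IsIntegralCurveOn (fun t => α (x, t)) (fun _ => f) (Icc 0 T)) ∧
      ContinuousOn α (closedBall x₀ 1 ×ˢ Icc 0 T) := by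
  obtain ⟨K, hK⟩ := hb
  have hK0 : 0 ≤ K := (norm_nonneg _).trans (hK x₀)
  lift K to ℝ≥0 using hK0
  lift T to ℝ≥0 using hT
  obtain ⟨L, hL⟩ := exists_lipschitzOnWith_closedBall hf x₀ ((K * T + 1 : ℝ≥0) : ℝ)
  have h := IsPicardLindelof.of_time_independent (t₀ := (⟨0, by simp⟩ : Icc (0 : ℝ) T))
    (r := 1) (L := K) (fun x _ => hK x) hL (by simp)
  obtain ⟨α, hα, hc⟩ := h.exists_forall_mem_closedBall_eq_hasDerivWithinAt_continuousOn
  exact ⟨α, by simpa [IsIntegralCurveOn] using hα, by simpa using hc⟩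

lemma exists_isIntegralCurveOn_Ici {f : Space d → Space d} (hf : ContDiff ℝ ∞ f)
    (hb : ∃ K : ℝ, ∀ x, ‖f x‖ ≤ K) (x : Space d) :
    ∃ γ : ℝ → Space d, γ 0 = x ∧ IsIntegralCurveOn γ (fun _ => f) (Ici 0) := by
  have h (n : ℕ) : ∃ γ : ℝ → Space d, γ 0 = x ∧ IsIntegralCurveOn γ (fun _ => f) (Icc 0 n) := by
    obtain ⟨α, hα, -⟩ := exists_local_flow hf hb x (Nat.cast_nonneg n)
    exact ⟨fun t => α (x, t), hα x (mem_closedBall_self zero_le_one)⟩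
  choose α hα0 hα using h
  -- the solutions on `[0, n]` are glued; they agree where they are both defined
  have key (n : ℕ) (s : ℝ) (hs : s ∈ Ico 0 (n : ℝ)) : α (⌊s⌋₊ + 1) s = α n s := by
    have h1 : ⌊s⌋₊ + 1 ≤ n := (Nat.floor_lt hs.1).2 hs.2
    refine eqOn_Icc_of_isIntegralCurveOn hf (hα _)
      ((hα n).mono (Icc_subset_Icc_right (by exact_mod_cast h1))) (by simp [hα0])
      ⟨hs.1, by exact_mod_cast (Nat.lt_floor_add_one s).le⟩
  refine ⟨fun t => α (⌊t⌋₊ + 1) t, by simp [hα0], fun t ht => ?_⟩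
  have htn : t < ((⌊t⌋₊ + 1 : ℕ) : ℝ) := by exact_mod_cast Nat.lt_floor_add_one t
  have hmem : Ico 0 ((⌊t⌋₊ + 1 : ℕ) : ℝ) ∈ 𝓝[Ici 0] t := by
    rw [← Ici_inter_Iio]
    exact Filter.inter_mem self_mem_nhdsWithin (mem_nhdsWithin_of_mem_nhds (Iio_mem_nhds htn))
  have h1 := (hα (⌊t⌋₊ + 1) t ⟨ht, htn.le⟩).mono_of_mem_nhdsWithin
    (Filter.mem_of_superset hmem Ico_subset_Icc_self)
  exact h1.congr_of_eventuallyEq (Filter.mem_of_superset hmem fun s hs => key _ s hs) rfl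

/-- The choice in the definition of `flow` picks a genuine solution on `[0, ∞)`. -/
lemma flow_spec {f : Space d → Space d} (hf : ContDiff ℝ ∞ f)
    (hb : ∃ K : ℝ, ∀ x, ‖f x‖ ≤ K) (x : Space d) :
    flow f 0 x = x ∧ IsIntegralCurveOn (fun t => flow f t x) (fun _ => f) (Ici 0) :=
  Classical.epsilon_spec (exists_isIntegralCurveOn_Ici hf hb x)

lemma continuousOn_flow {f : Space d → Space d} (hf : ContDiff ℝ ∞ f)
    (hb : ∃ K : ℝ, ∀ x, ‖f x‖ ≤ K) :
    ContinuousOn (fun p : Space d × ℝ => flow f p.2 p.1) (univ ×ˢ Ici 0) := by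
  rintro ⟨x, t⟩ ⟨-, ht⟩
  have ht : 0 ≤ t := ht
  obtain ⟨α, hα, hc⟩ := exists_local_flow hf hb x (add_nonneg ht zero_le_one)
  have hmem : closedBall x 1 ×ˢ Icc 0 (t + 1) ∈ 𝓝[univ ×ˢ Ici 0] (x, t) := by
    rw [nhdsWithin_prod_eq, nhdsWithin_univ]
    refine Filter.prod_mem_prod (closedBall_mem_nhds x zero_lt_one) ?_
    rw [← Ici_inter_Iic]
    exact Filter.inter_mem self_mem_nhdsWithin
      (mem_nhdsWithin_of_mem_nhds (Iic_mem_nhds (lt_add_one t)))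
  have heq : ∀ p ∈ closedBall x 1 ×ˢ Icc 0 (t + 1), flow f p.2 p.1 = α p := by
    rintro ⟨y, s⟩ ⟨hy, hs⟩
    exact eqOn_Icc_of_isIntegralCurveOn hf ((flow_spec hf hb y).2.mono Icc_subset_Ici_self)
      (hα y hy).2 ((flow_spec hf hb y).1.trans (hα y hy).1.symm) hs
  have hx : (x, t) ∈ closedBall x 1 ×ˢ Icc 0 (t + 1) :=
    ⟨mem_closedBall_self zero_le_one, ht, (lt_add_one t).le⟩
  exact ((hc _ hx).mono_of_mem_nhdsWithin hmem).congr_of_eventuallyEq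
    (Filter.mem_of_superset hmem heq) (heq _ hx)

lemma continuous_flow {f : Space d → Space d} (hf : ContDiff ℝ ∞ f)
    (hb : ∃ K : ℝ, ∀ x, ‖f x‖ ≤ K) {t : ℝ} (ht : 0 ≤ t) : Continuous (flow f t) :=
  (continuousOn_flow hf hb).comp_continuous (f := fun x => (x, t)) (by fun_prop)
    (fun _ => ⟨mem_univ _, ht⟩)

/-! ### Flow-invariant closed sets are positively invariant -/

/-- Forward invariance under the semiflow of each of the vector fields `F i`. -/
def FlowInvariant (F : Fin (m + 1) → Space d → Space d) (S : Set (Space d)) : Prop :=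
  ∀ i t, 0 ≤ t → ∀ x ∈ S, flow (F i) t x ∈ S

lemma FlowInvariant.closure (hF : ∀ i, ContDiff ℝ ∞ (F i)) (hb : ∀ i, ∃ K : ℝ, ∀ x, ‖F i x‖ ≤ K)
    {S : Set (Space d)} (hS : FlowInvariant F S) : FlowInvariant F (closure S) :=
  fun i t ht _ hx =>
    map_mem_closure (continuous_flow (hF i) (hb i) ht) hx fun y hy => hS i t ht y hy

lemma sum_stdSimplex_mul_le {v c : Fin (m + 1) → ℝ} (hv : v ∈ stdSimplex ℝ (Fin (m + 1))) {C : ℝ}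
    (hc : ∀ i, c i ≤ C) : ∑ i, v i * c i ≤ C :=
  calc ∑ i, v i * c i ≤ ∑ i, v i * C :=
        Finset.sum_le_sum fun i _ => mul_le_mul_of_nonneg_left (hc i) (hv.1 i)
    _ = C := by rw [← Finset.sum_mul, hv.2, one_mul]

lemma norm_sum_stdSimplex_smul_le {v : Fin (m + 1) → ℝ} (hv : v ∈ stdSimplex ℝ (Fin (m + 1)))
    {a : Fin (m + 1) → Space d} {C : ℝ} (ha : ∀ i, ‖a i‖ ≤ C) : ‖∑ i, v i • a i‖ ≤ C :=
  (norm_sum_le _ _).trans <| by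
    simpa only [norm_smul, Real.norm_of_nonneg (hv.1 _)] using sum_stdSimplex_mul_le hv ha

lemma exists_forall_norm_le (hb : ∀ i, ∃ K : ℝ, ∀ x, ‖F i x‖ ≤ K) :
    ∃ K : ℝ, 0 ≤ K ∧ ∀ i x, ‖F i x‖ ≤ K := by
  choose K hK using hb
  refine ⟨∑ i, K i, Finset.sum_nonneg fun i _ => (norm_nonneg _).trans (hK i 0), fun i x =>
    (hK i x).trans (Finset.single_le_sum (f := K)
      (fun j _ => (norm_nonneg _).trans (hK j 0)) (Finset.mem_univ i))⟩

lemma exists_forall_lipschitzOnWith_closedBall (hF : ∀ i, ContDiff ℝ ∞ (F i)) (x : Space d)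
    (R : ℝ) : ∃ L : ℝ≥0, ∀ i, LipschitzOnWith L (F i) (closedBall x R) := by
  choose L hL using fun i => exists_lipschitzOnWith_closedBall (hF i) x R
  exact ⟨∑ i, L i, fun i => (hL i).weaken
    (Finset.single_le_sum (f := L) (fun _ _ => bot_le) (Finset.mem_univ i))⟩

lemma intervalIntegrable_velocity (hF : ∀ i, Continuous (F i))
    {K : ℝ} (hK : ∀ i x, ‖F i x‖ ≤ K) {v : ℝ → Fin (m + 1) → ℝ} {γ : ℝ → Space d}
    (hv : IsControl v) (hγ : ContinuousOn γ (Ici 0)) {a b : ℝ} (ha : 0 ≤ a) (hb : 0 ≤ b) :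
    IntervalIntegrable (fun s => ∑ i, v s i • F i (γ s)) volume a b := by
  rw [intervalIntegrable_iff]
  have hsub : uIoc a b ⊆ Ici 0 := fun s hs => (le_min ha hb).trans hs.1.le
  have : IsFiniteMeasure (volume.restrict (uIoc a b)) := ⟨by simp [uIoc]⟩
  refine Integrable.of_bound ?_ K ?_
  · refine Finset.aestronglyMeasurable_fun_sum _ fun i _ => ?_
    exact ((measurable_pi_apply i).comp hv.1).aestronglyMeasurable.smul
      (((hF i).comp_continuousOn (hγ.mono hsub)).aestronglyMeasurable measurableSet_uIoc)
  · exact (ae_restrict_iff' measurableSet_uIoc).2 <| .of_forall fun s hs =>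
      norm_sum_stdSimplex_smul_le (hv.2 s (hsub hs)) fun i => hK i _

lemma IsTrajectory.eq_zero {v : ℝ → Fin (m + 1) → ℝ} {γ : ℝ → Space d} {x : Space d}
    (hγ : IsTrajectory F v x γ) : γ 0 = x := by
  simpa using hγ.2 0 le_rfl

lemma IsTrajectory.sub_eq_integral (hF : ∀ i, Continuous (F i))
    {K : ℝ} (hK : ∀ i x, ‖F i x‖ ≤ K) {v : ℝ → Fin (m + 1) → ℝ} {γ : ℝ → Space d} {x : Space d}
    (hv : IsControl v) (hγ : IsTrajectory F v x γ) {a b : ℝ} (ha : 0 ≤ a) (hb : 0 ≤ b) :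
    γ b - γ a = ∫ s in a..b, ∑ i, v s i • F i (γ s) := by
  rw [hγ.2 a ha, hγ.2 b hb, add_sub_add_left_eq_sub, intervalIntegral.integral_interval_sub_left
    (intervalIntegrable_velocity hF hK hv hγ.1 le_rfl hb)
    (intervalIntegrable_velocity hF hK hv hγ.1 le_rfl ha)]

lemma IsTrajectory.norm_sub_le (hF : ∀ i, Continuous (F i))
    {K : ℝ} (hK : ∀ i x, ‖F i x‖ ≤ K) {v : ℝ → Fin (m + 1) → ℝ} {γ : ℝ → Space d} {x : Space d}
    (hv : IsControl v) (hγ : IsTrajectory F v x γ) {a b : ℝ} (ha : 0 ≤ a) (hab : a ≤ b) :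
    ‖γ b - γ a‖ ≤ K * (b - a) := by
  rw [hγ.sub_eq_integral hF hK hv ha (ha.trans hab), ← abs_of_nonneg (sub_nonneg.2 hab)]
  refine intervalIntegral.norm_integral_le_of_norm_le_const fun s hs => ?_
  rw [uIoc_of_le hab] at hs
  exact norm_sum_stdSimplex_smul_le (hv.2 s (ha.trans hs.1.le)) fun i => hK i _

/-- At a point `y` of a flow-invariant set that is nearest to `p`, the vector fields do not point
towards `p`: otherwise following the flow would decrease the distance to `p`. -/
lemma FlowInvariant.inner_nonpos (hF : ∀ i, ContDiff ℝ ∞ (F i))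
    (hb : ∀ i, ∃ K : ℝ, ∀ x, ‖F i x‖ ≤ K) {S : Set (Space d)} (hS : FlowInvariant F S)
    {p y : Space d} (hy : y ∈ S) (hmin : ∀ z ∈ S, ‖p - y‖ ≤ ‖p - z‖) (i : Fin (m + 1)) :
    inner ℝ (p - y) (F i y) ≤ 0 := by
  obtain ⟨h0, hγ⟩ := flow_spec (hF i) (hb i) y
  have hd := ((hγ 0 self_mem_Ici).const_sub p).norm_sq
  simp only [h0] at hd
  rw [hasDerivWithinAt_iff_tendsto_slope, Ici_sdiff_left] at hd
  have := ge_of_tendsto hd (b := 0) <| by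
    filter_upwards [self_mem_nhdsWithin] with t ht
    have ht : 0 < t := ht
    have h1 := hmin _ (hS i t ht.le y hy)
    simp only [slope_def_field, h0, sub_zero]
    exact div_nonneg (sub_nonneg.2 (pow_le_pow_left₀ (norm_nonneg _) h1 2)) ht.le
  rw [inner_neg_right] at this
  linarith

/-- A one-step estimate for the squared distance of a trajectory to a flow-invariant set, with
Grönwall constant `2 * L` and a quadratic error in the length of the step. -/
lemma FlowInvariant.infDist_sq_le (hF : ∀ i, ContDiff ℝ ∞ (F i))
    (hb : ∀ i, ∃ K : ℝ, ∀ x, ‖F i x‖ ≤ K) {S : Set (Space d)} (hS : FlowInvariant F S)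
    {K : ℝ} (hK : ∀ i x, ‖F i x‖ ≤ K) {v : ℝ → Fin (m + 1) → ℝ} {γ : ℝ → Space d} {x : Space d}
    (hv : IsControl v) (hγ : IsTrajectory F v x γ) {B : Set (Space d)} {L : ℝ≥0}
    (hL : ∀ i, LipschitzOnWith L (F i) B) {t z : ℝ} (ht : 0 ≤ t) (htz : t ≤ z)
    (hB : ∀ s ∈ Icc t z, γ s ∈ B) {y : Space d} (hyB : y ∈ B) (hyS : y ∈ S)
    (hy : infDist (γ t) S = dist (γ t) y) :
    infDist (γ z) S ^ 2 ≤ infDist (γ t) S ^ 2 + 2 * L * infDist (γ t) S ^ 2 * (z - t) +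
      (2 * infDist (γ t) S * L * K + K ^ 2) * (z - t) ^ 2 := by
  have hFc : ∀ i, Continuous (F i) := fun i => (hF i).continuous
  set D := infDist (γ t) S with hD
  set w := γ t - y with hw
  have hwD : ‖w‖ = D := by rw [hy, dist_eq_norm]
  have hD0 : 0 ≤ D := infDist_nonneg
  have hmin : ∀ u ∈ S, ‖γ t - y‖ ≤ ‖γ t - u‖ := fun u hu => by
    rw [← dist_eq_norm, ← dist_eq_norm, ← hy]; exact infDist_le_dist_of_mem hu
  have hpt : ∀ s ∈ Icc t z, ∀ i,
      inner ℝ w (F i (γ s)) ≤ L * D ^ 2 + D * L * K * (z - t) := by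
    intro s hs i
    have e : F i (γ s) = F i y + (F i (γ t) - F i y) + (F i (γ s) - F i (γ t)) := by abel
    have h1 := hS.inner_nonpos hF hb hyS hmin i
    have h2 : inner ℝ w (F i (γ t) - F i y) ≤ D * (L * D) :=
      (real_inner_le_norm _ _).trans <| by
        rw [hwD]
        have := (hL i).norm_sub_le (hB t (left_mem_Icc.2 htz)) hyB
        rw [← hw, hwD] at this
        gcongr
    have h3 : inner ℝ w (F i (γ s) - F i (γ t)) ≤ D * (L * (K * (z - t))) :=
      (real_inner_le_norm _ _).trans <| by
        rw [hwD]
        have h4 := (hL i).norm_sub_le (hB s hs) (hB t (left_mem_Icc.2 htz))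
        have h5 := hγ.norm_sub_le hFc hK hv ht hs.1
        have hK0 : 0 ≤ K := (norm_nonneg _).trans (hK i 0)
        have h6 : K * (s - t) ≤ K * (z - t) := by gcongr; exact hs.2
        have h7 : (L : ℝ) * ‖γ s - γ t‖ ≤ L * (K * (z - t)) := by gcongr; exact h5.trans h6
        gcongr
        exact h4.trans h7
    rw [e, inner_add_right, inner_add_right]
    linarith
  have hint := intervalIntegrable_velocity hFc hK hv hγ.1 ht (ht.trans htz)
  have hinner : inner ℝ w (γ z - γ t) ≤ (L * D ^ 2 + D * L * K * (z - t)) * (z - t) := by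
    rw [hγ.sub_eq_integral hFc hK hv ht (ht.trans htz)]
    have hcomm := (innerSL ℝ w).intervalIntegral_comp_comm hint
    simp only [innerSL_apply_apply] at hcomm
    rw [← hcomm]
    have hint' := (⟨(innerSL ℝ w).integrable_comp hint.1, (innerSL ℝ w).integrable_comp hint.2⟩ :
      IntervalIntegrable (fun s => innerSL ℝ w (∑ i, v s i • F i (γ s))) volume t z)
    refine (intervalIntegral.integral_mono_on htz hint' intervalIntegrable_const
      (g := fun _ => L * D ^ 2 + D * L * K * (z - t)) fun s hs => ?_).trans ?_
    · rw [innerSL_apply_apply, inner_sum]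
      simp only [inner_smul_right]
      exact sum_stdSimplex_mul_le (hv.2 s (ht.trans hs.1)) (hpt s hs)
    · rw [intervalIntegral.integral_const, smul_eq_mul, mul_comm]
  have hnorm : ‖γ z - γ t‖ ^ 2 ≤ (K * (z - t)) ^ 2 :=
    pow_le_pow_left₀ (norm_nonneg _) (hγ.norm_sub_le hFc hK hv ht htz) 2
  have hz : infDist (γ z) S ^ 2 ≤ ‖w + (γ z - γ t)‖ ^ 2 := by
    refine pow_le_pow_left₀ infDist_nonneg ((infDist_le_dist_of_mem hyS).trans_eq ?_) 2
    rw [dist_eq_norm, hw]; congr 1; abel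
  rw [norm_add_sq_real, hwD] at hz
  nlinarith

/-- A closed set that is invariant under the semiflow of each vector field is invariant under all
trajectories of the control system, also those whose control takes values in the interior of the
simplex. -/
theorem FlowInvariant.positivelyInvariant (hF : ∀ i, ContDiff ℝ ∞ (F i))
    (hb : ∀ i, ∃ K : ℝ, ∀ x, ‖F i x‖ ≤ K) {S : Set (Space d)} (hS : FlowInvariant F S)
    (hSc : IsClosed S) : PositivelyInvariant F S := by
  intro x hx v γ hv hγ T hT
  obtain ⟨K, hK0, hK⟩ := exists_forall_norm_le hb
  have hFc : ∀ i, Continuous (F i) := fun i => (hF i).continuous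
  -- the trajectory up to time `T` and its nearest points in `S` stay in this ball
  obtain ⟨L, hL⟩ := exists_forall_lipschitzOnWith_closedBall hF x (2 * (K * T))
  have hdist : ∀ s ∈ Icc 0 T, dist (γ s) x ≤ K * T := fun s hs => by
    have := hγ.norm_sub_le hFc hK hv le_rfl hs.1
    rw [hγ.eq_zero, sub_zero] at this
    rw [dist_eq_norm]
    exact this.trans (by gcongr; exact hs.2)
  have hKT : 0 ≤ K * T := mul_nonneg hK0 hT
  have hB : ∀ s ∈ Icc 0 T, γ s ∈ closedBall x (2 * (K * T)) := fun s hs =>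
    mem_closedBall.2 ((hdist s hs).trans (by linarith))
  have hcont : ContinuousOn (fun t => infDist (γ t) S ^ 2) (Icc 0 T) :=
    (((continuous_infDist_pt S).comp_continuousOn hγ.1).pow 2).mono Icc_subset_Ici_self
  have key := le_gronwallBound_of_liminf_deriv_right_le (δ := 0) (K := 2 * L) (ε := 0)
    (f' := fun t => 2 * L * infDist (γ t) S ^ 2) hcont ?_
    (by simp [hγ.eq_zero, infDist_zero_of_mem hx]) (fun _ _ => by simp) T ⟨hT, le_rfl⟩
  · rw [gronwallBound_ε0_δ0] at key
    have h0 : infDist (γ T) S = 0 := by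
      have := sq_nonneg (infDist (γ T) S)
      exact pow_eq_zero_iff two_ne_zero |>.1 (le_antisymm key this)
    exact (hSc.mem_iff_infDist_zero ⟨x, hx⟩).2 h0
  · intro t ht r hr
    obtain ⟨y, hyS, hy⟩ := hSc.exists_infDist_eq_dist ⟨x, hx⟩ (γ t)
    have hyB : y ∈ closedBall x (2 * (K * T)) := by
      have h1 : dist (γ t) y ≤ dist (γ t) x := hy ▸ infDist_le_dist_of_mem hx
      have h2 := hdist t (Ico_subset_Icc_self ht)
      have h3 := dist_triangle_left y x (γ t)
      exact mem_closedBall.2 (by linarith)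
    set C := 2 * infDist (γ t) S * L * K + K ^ 2 with hC
    have hlim : Filter.Tendsto (fun z => 2 * L * infDist (γ t) S ^ 2 + C * (z - t)) (𝓝[>] t)
        (𝓝 (2 * L * infDist (γ t) S ^ 2)) := by
      refine tendsto_nhdsWithin_of_tendsto_nhds ?_
      exact Continuous.tendsto' (by fun_prop) _ _ (by simp)
    refine Filter.Eventually.frequently ?_
    filter_upwards [hlim.eventually_lt_const hr, Ioo_mem_nhdsGT ht.2] with z hz hzT
    have hzt : 0 < z - t := sub_pos.2 hzT.1
    have := hS.infDist_sq_le hF hb hK hv hγ hL ht.1 hzT.1.le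
      (fun s hs => hB s ⟨ht.1.trans hs.1, hs.2.trans hzT.2.le⟩) hyB hyS hy
    refine lt_of_le_of_lt ?_ hz
    rw [inv_mul_le_iff₀ hzt]
    rw [← hC] at this
    linarith

/-! ### Reachable sets -/

lemma isControl_const_single (i : Fin (m + 1)) :
    IsControl (fun _ : ℝ => (Pi.single i 1 : Fin (m + 1) → ℝ)) :=
  ⟨measurable_const, fun _ _ => single_mem_stdSimplex ℝ i⟩

lemma isTrajectory_flow (hF : ∀ i, ContDiff ℝ ∞ (F i)) (hb : ∀ i, ∃ K : ℝ, ∀ x, ‖F i x‖ ≤ K)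
    (i : Fin (m + 1)) (x : Space d) :
    IsTrajectory F (fun _ => Pi.single i 1) x (fun t => flow (F i) t x) := by
  obtain ⟨h0, hγ⟩ := flow_spec (hF i) (hb i) x
  have hc : ContinuousOn (fun t => flow (F i) t x) (Ici 0) := HasDerivWithinAt.continuousOn hγ
  refine ⟨hc, fun t ht => ?_⟩
  have hsum (s : ℝ) : ∑ j, (Pi.single i 1 : Fin (m + 1) → ℝ) j • F j (flow (F i) s x) =
      F i (flow (F i) s x) := by
    simp [Pi.single_apply, ite_smul]
  simp only [hsum]
  have hsub : Icc 0 t ⊆ Ici (0 : ℝ) := Icc_subset_Ici_self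
  rw [intervalIntegral.integral_eq_sub_of_hasDeriv_right_of_le ht (hc.mono hsub)
    (fun s hs => (hγ s hs.1.le).mono (Ioi_subset_Ici hs.1.le)) ?_, h0, add_sub_cancel]
  refine ((hF i).continuous.comp_continuousOn (hc.mono ?_)).intervalIntegrable
  rwa [uIcc_of_le ht]

/-- Concatenation of two controls, or of two trajectories, at time `t₁`. -/
noncomputable def concat {α : Type*} (t₁ : ℝ) (a b : ℝ → α) (s : ℝ) : α :=
  if s ≤ t₁ then a s else b (s - t₁)

lemma IsControl.concat {v₁ v₂ : ℝ → Fin (m + 1) → ℝ} (h₁ : IsControl v₁) (h₂ : IsControl v₂)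
    (t₁ : ℝ) : IsControl (concat t₁ v₁ v₂) := by
  refine ⟨Measurable.ite measurableSet_Iic h₁.1 (h₂.1.comp (measurable_id.sub_const t₁)),
    fun t ht => ?_⟩
  unfold PDMP.concat
  split_ifs with h
  · exact h₁.2 t ht
  · exact h₂.2 _ (sub_nonneg.2 (not_le.1 h).le)

lemma IsTrajectory.concat (hF : ∀ i, Continuous (F i)) (hb : ∀ i, ∃ K : ℝ, ∀ x, ‖F i x‖ ≤ K)
    {v₁ v₂ : ℝ → Fin (m + 1) → ℝ} {γ₁ γ₂ : ℝ → Space d} {x : Space d} {t₁ : ℝ} (ht₁ : 0 ≤ t₁)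
    (hv₁ : IsControl v₁) (hv₂ : IsControl v₂) (h₁ : IsTrajectory F v₁ x γ₁)
    (h₂ : IsTrajectory F v₂ (γ₁ t₁) γ₂) :
    IsTrajectory F (concat t₁ v₁ v₂) x (concat t₁ γ₁ γ₂) := by
  obtain ⟨K, -, hK⟩ := exists_forall_norm_le hb
  have hleft : ∀ s ∈ Icc 0 t₁, PDMP.concat t₁ γ₁ γ₂ s = γ₁ s := fun s hs => if_pos hs.2
  have hright : ∀ s ∈ Ici t₁, PDMP.concat t₁ γ₁ γ₂ s = γ₂ (s - t₁) := by
    intro s hs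
    rcases eq_or_lt_of_le (show t₁ ≤ s from hs) with rfl | hlt
    · simp [PDMP.concat, h₂.eq_zero]
    · exact if_neg hlt.not_ge
  have hc : ContinuousOn (PDMP.concat t₁ γ₁ γ₂) (Ici 0) := by
    rw [← Icc_union_Ici_eq_Ici ht₁]
    refine ContinuousOn.union_of_isClosed ?_ ?_ isClosed_Icc isClosed_Ici
    · exact (h₁.1.mono Icc_subset_Ici_self).congr hleft
    · refine ContinuousOn.congr (f := fun s => γ₂ (s - t₁)) ?_ hright
      exact h₂.1.comp (by fun_prop) fun s (hs : t₁ ≤ s) => sub_nonneg.2 hs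
  refine ⟨hc, fun t ht => ?_⟩
  have e₁ : ∀ r ∈ Icc 0 t₁, ∫ s in (0 : ℝ)..r, ∑ i, PDMP.concat t₁ v₁ v₂ s i •
      F i (PDMP.concat t₁ γ₁ γ₂ s) = ∫ s in (0 : ℝ)..r, ∑ i, v₁ s i • F i (γ₁ s) := by
    refine fun r hr => intervalIntegral.integral_congr fun s hs => ?_
    rw [uIcc_of_le hr.1] at hs
    have : s ≤ t₁ := hs.2.trans hr.2
    simp [PDMP.concat, this]
  rcases le_total t t₁ with htt | htt
  · rw [e₁ t ⟨ht, htt⟩, hleft t ⟨ht, htt⟩, h₁.2 t ht]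
  · have hv := hv₁.concat hv₂ t₁
    have hFv {a b : ℝ} := intervalIntegrable_velocity (a := a) (b := b) hF hK hv hc
    rw [← intervalIntegral.integral_add_adjacent_intervals (hFv le_rfl ht₁) (hFv ht₁ ht),
      e₁ t₁ ⟨ht₁, le_rfl⟩, ← add_assoc, ← h₁.2 t₁ ht₁, hright t htt, h₂.2 _ (sub_nonneg.2 htt)]
    congr 1
    rw [← sub_self t₁, ← intervalIntegral.integral_comp_sub_right
      (fun s => ∑ i, v₂ s i • F i (γ₂ s)) t₁]
    refine intervalIntegral.integral_congr_ae (.of_forall fun s hs => ?_)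
    rw [uIoc_of_le htt] at hs
    simp [PDMP.concat, hs.1.not_ge]

lemma reachLE_subset_reach (T : ℝ) (x : Space d) : reachLE F T x ⊆ reach F x := by
  rintro y ⟨v, γ, hv, hγ, t, ht, rfl⟩
  exact mem_iUnion₂.2 ⟨max T 1, by positivity, v, γ, hv, hγ, t,
    ⟨ht.1, ht.2.trans (le_max_left _ _)⟩, rfl⟩

lemma mem_reach_iff {x y : Space d} :
    y ∈ reach F x ↔ ∃ v γ, IsControl v ∧ IsTrajectory F v x γ ∧ ∃ t, 0 ≤ t ∧ γ t = y := by
  constructor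
  · intro h
    obtain ⟨T, -, v, γ, hv, hγ, t, ht, rfl⟩ := mem_iUnion₂.1 h
    exact ⟨v, γ, hv, hγ, t, ht.1, rfl⟩
  · rintro ⟨v, γ, hv, hγ, t, ht, rfl⟩
    exact reachLE_subset_reach t x ⟨v, γ, hv, hγ, t, ⟨ht, le_rfl⟩, rfl⟩

lemma mem_reach_trans (hF : ∀ i, ContDiff ℝ ∞ (F i)) (hb : ∀ i, ∃ K : ℝ, ∀ x, ‖F i x‖ ≤ K)
    {x y z : Space d} (hy : y ∈ reach F x) (hz : z ∈ reach F y) : z ∈ reach F x := by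
  obtain ⟨v₁, γ₁, hv₁, h₁, t₁, ht₁, rfl⟩ := mem_reach_iff.1 hy
  obtain ⟨v₂, γ₂, hv₂, h₂, t₂, ht₂, rfl⟩ := mem_reach_iff.1 hz
  refine mem_reach_iff.2 ⟨_, _, hv₁.concat hv₂ t₁,
    h₁.concat (fun i => (hF i).continuous) hb ht₁ hv₁ hv₂ h₂, t₁ + t₂, by positivity, ?_⟩
  rcases ht₂.eq_or_lt with rfl | h
  · simp [concat, h₂.eq_zero]
  · simp [concat, h.not_ge]

lemma flow_mem_reach (hF : ∀ i, ContDiff ℝ ∞ (F i)) (hb : ∀ i, ∃ K : ℝ, ∀ x, ‖F i x‖ ≤ K)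
    (i : Fin (m + 1)) {t : ℝ} (ht : 0 ≤ t) (x : Space d) : flow (F i) t x ∈ reach F x :=
  mem_reach_iff.2 ⟨_, _, isControl_const_single i, isTrajectory_flow hF hb i x, t, ht, rfl⟩

lemma self_mem_reach (hF : ∀ i, ContDiff ℝ ∞ (F i)) (hb : ∀ i, ∃ K : ℝ, ∀ x, ‖F i x‖ ≤ K)
    (x : Space d) : x ∈ reach F x := by
  simpa [(flow_spec (hF 0) (hb 0) x).1] using flow_mem_reach hF hb 0 le_rfl x

lemma PositivelyInvariant.reach_subset {S : Set (Space d)} (hS : PositivelyInvariant F S)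
    {x : Space d} (hx : x ∈ S) : reach F x ⊆ S := by
  intro y hy
  obtain ⟨v, γ, hv, hγ, t, ht, rfl⟩ := mem_reach_iff.1 hy
  exact hS x hx v γ hv hγ t ht

lemma PositivelyInvariant.flowInvariant (hF : ∀ i, ContDiff ℝ ∞ (F i))
    (hb : ∀ i, ∃ K : ℝ, ∀ x, ‖F i x‖ ≤ K) {S : Set (Space d)} (hS : PositivelyInvariant F S) :
    FlowInvariant F S :=
  fun i _ ht x hx => hS.reach_subset hx (flow_mem_reach hF hb i ht x)

lemma positivelyInvariant_closure_reach (hF : ∀ i, ContDiff ℝ ∞ (F i))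
    (hb : ∀ i, ∃ K : ℝ, ∀ x, ‖F i x‖ ≤ K) (x : Space d) :
    PositivelyInvariant F (closure (reach F x)) := by
  have h : FlowInvariant F (reach F x) := fun i t ht y hy =>
    mem_reach_trans hF hb hy (flow_mem_reach hF hb i ht y)
  exact (h.closure hF hb).positivelyInvariant hF hb isClosed_closure

/-! ### Existence of invariant control sets -/

lemma isPreControlSet_of_positivelyInvariant (hF : ∀ i, ContDiff ℝ ∞ (F i))
    (hb : ∀ i, ∃ K : ℝ, ∀ x, ‖F i x‖ ≤ K) {D : Set (Space d)} (hne : D.Nonempty)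
    (hD : PositivelyInvariant F D) (hcl : ∀ x ∈ D, D ⊆ closure (reach F x)) :
    IsPreControlSet F D where
  nonempty := hne
  controlled_invariant x hx := ⟨_, _, isControl_const_single 0, isTrajectory_flow hF hb 0 x,
    hD x hx _ _ (isControl_const_single 0) (isTrajectory_flow hF hb 0 x)⟩
  subset_closure_reach := hcl

/-- A minimal nonempty closed flow-invariant subset of a compact flow-invariant set is an invariant
control set: by minimality it is the closure of the reachable set of each of its points. -/
theorem exists_isInvariantControlSet_subset (hF : ∀ i, ContDiff ℝ ∞ (F i))
    (hb : ∀ i, ∃ K : ℝ, ∀ x, ‖F i x‖ ≤ K) {S : Set (Space d)} (hSc : IsCompact S)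
    (hne : S.Nonempty) (hS : FlowInvariant F S) : ∃ C ⊆ S, IsInvariantControlSet F C := by
  obtain ⟨C, hCS, hC⟩ := zorn_superset_nonempty
    {A : Set (Space d) | A ⊆ S ∧ A.Nonempty ∧ IsClosed A ∧ FlowInvariant F A} (by
      intro c hc hchain hcne
      have : Nonempty c := hcne.to_subtype
      refine ⟨⋂₀ c, ⟨?_, ?_, ?_, ?_⟩, fun s hs => sInter_subset_of_mem hs⟩
      · obtain ⟨A, hA⟩ := hcne
        exact (sInter_subset_of_mem hA).trans (hc hA).1
      · exact IsCompact.nonempty_sInter_of_directed_nonempty_isCompact_isClosed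
          (fun A hA B hB => (hchain.total hA hB).elim (fun h => ⟨A, hA, Subset.rfl, h⟩)
            fun h => ⟨B, hB, h, Subset.rfl⟩) (fun A hA => (hc hA).2.1)
          (fun A hA => hSc.of_isClosed_subset (hc hA).2.2.1 (hc hA).1)
          (fun A hA => (hc hA).2.2.1)
      · exact isClosed_sInter fun A hA => (hc hA).2.2.1
      · exact fun i t ht x hx A hA => (hc hA).2.2.2 i t ht x (hx A hA))
    S ⟨Subset.rfl, hne, hSc.isClosed, hS⟩
  obtain ⟨-, hCne, hCc, hCF⟩ := hC.prop
  have hCP : PositivelyInvariant F C := hCF.positivelyInvariant hF hb hCc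
  have heq : ∀ x ∈ C, closure (reach F x) = C := fun x hx => by
    have hsub : closure (reach F x) ⊆ C := closure_minimal (hCP.reach_subset hx) hCc
    exact hsub.antisymm (hC.le_of_le ⟨hsub.trans hCS, ⟨x, subset_closure (self_mem_reach hF hb x)⟩,
      isClosed_closure, (positivelyInvariant_closure_reach hF hb x).flowInvariant hF hb⟩ hsub)
  refine ⟨C, hCS, ⟨isPreControlSet_of_positivelyInvariant hF hb hCne hCP
    fun x hx => (heq x hx).ge, fun D hD hCD => ?_⟩, fun x hx => ?_⟩
  · obtain ⟨x, hx⟩ := hCne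
    exact (hD.subset_closure_reach x (hCD hx)).trans (heq x hx).le
  · rw [heq x hx, hCc.closure_eq]

lemma IsInvariantControlSet.positivelyInvariant {C : Set (Space d)}
    (hC : IsInvariantControlSet F C) (hCc : IsClosed C) : PositivelyInvariant F C := by
  intro x hx v γ hv hγ t ht
  have h : γ t ∈ closure (reach F x) :=
    subset_closure (mem_reach_iff.2 ⟨v, γ, hv, hγ, t, ht, rfl⟩)
  rwa [← hC.2 x hx, hCc.closure_eq] at h

lemma IsInvariantControlSet.eq_of_inter_nonempty {C D : Set (Space d)}
    (hC : IsInvariantControlSet F C) (hD : IsInvariantControlSet F D) (hCc : IsClosed C)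
    (hDc : IsClosed D) (h : (C ∩ D).Nonempty) : C = D := by
  obtain ⟨x, hxC, hxD⟩ := h
  rw [← hCc.closure_eq, ← hDc.closure_eq, hC.2 x hxC, hD.2 x hxD]

/-! ### Invariant control sets under local accessibility -/

lemma LocallyAccessibleOn.nonempty_interior_reach_inter {M : Set (Space d)}
    (hM : LocallyAccessibleOn F M) {x : Space d} (hx : x ∈ M) {U : Set (Space d)} (hU : U ∈ 𝓝 x) :
    (interior (reach F x) ∩ U).Nonempty :=
  (hM x hx 1 one_pos U hU).1.mono
    (inter_subset_inter_left _ (interior_mono (reachLE_subset_reach 1 x)))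

lemma LocallyAccessibleOn.isClosed_of_mem (hF : ∀ i, ContDiff ℝ ∞ (F i))
    (hb : ∀ i, ∃ K : ℝ, ∀ x, ‖F i x‖ ≤ K) {M : Set (Space d)} (hMc : IsClosed M)
    (hacc : LocallyAccessibleOn F M) {C : Set (Space d)} (hC : C ∈ invariantControlSets F M) :
    IsClosed C := by
  obtain ⟨x₀, hx₀⟩ := hC.1.1.prop.nonempty
  have hP : PositivelyInvariant F (closure C) :=
    hC.1.2 x₀ hx₀ ▸ positivelyInvariant_closure_reach hF hb x₀
  refine isClosed_of_closure_subset (hC.1.1.le_of_ge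
    (isPreControlSet_of_positivelyInvariant hF hb ⟨x₀, subset_closure hx₀⟩ hP fun x hx => ?_)
    subset_closure)
  -- the reachable set of `x` has interior points in `closure C`, so it contains a point of `C`
  obtain ⟨y, hy, -⟩ := hacc.nonempty_interior_reach_inter
    (closure_minimal hC.2 hMc hx) Filter.univ_mem
  obtain ⟨z, hz, hzC⟩ := mem_closure_iff.1 (hP.reach_subset hx (interior_subset hy)) _
    isOpen_interior hy
  rw [hC.1.2 z hzC]
  exact closure_mono fun w hw => mem_reach_trans hF hb (interior_subset hz) hw

/-- The points all of whose neighbourhoods meet infinitely many invariant control sets form a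
closed flow-invariant set. An invariant control set inside it would have interior points, but a
neighbourhood of such a point meets only one invariant control set. -/
lemma finite_invariantControlSets (hF : ∀ i, ContDiff ℝ ∞ (F i))
    (hb : ∀ i, ∃ K : ℝ, ∀ x, ‖F i x‖ ≤ K) {M : Set (Space d)} (hMc : IsCompact M)
    (hcl : ∀ C ∈ invariantControlSets F M, IsClosed C)
    (hint : ∀ C ∈ invariantControlSets F M, (interior C).Nonempty) :
    (invariantControlSets F M).Finite := by
  by_contra hinf
  set 𝒞 := invariantControlSets F M with h𝒞
  let N : Set (Space d) := {x | ∀ U ∈ 𝓝 x, {C ∈ 𝒞 | (C ∩ U).Nonempty}.Infinite}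
  have hNM : N ⊆ M := fun x hx => by
    by_contra hxM
    refine hx _ (hMc.isClosed.isOpen_compl.mem_nhds hxM) ?_
    convert finite_empty using 1
    ext C
    simp only [mem_ofPred_eq, mem_empty_iff_false, iff_false, not_and]
    rintro hC ⟨y, hyC, hyM⟩
    exact hyM (hC.2 hyC)
  have hNc : IsClosed N := by
    refine isClosed_of_closure_subset fun x hx U hU => ?_
    obtain ⟨y, hyU, hyN⟩ := mem_closure_iff_nhds.1 hx _ (interior_mem_nhds.2 hU)
    exact hyN U (mem_interior_iff_mem_nhds.1 hyU)
  have hNne : N.Nonempty := by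
    by_contra hN
    have key : {C ∈ 𝒞 | (C ∩ M).Nonempty}.Finite := by
      refine hMc.induction_on (p := fun s => {C ∈ 𝒞 | (C ∩ s).Nonempty}.Finite) (by simp) ?_ ?_ ?_
      · exact fun s t hst ht => ht.subset fun C hC =>
          ⟨hC.1, hC.2.mono (inter_subset_inter_right _ hst)⟩
      · intro s t hs ht
        refine (hs.union ht).subset fun C hC => ?_
        obtain ⟨y, hyC, hy | hy⟩ := hC.2
        · exact Or.inl ⟨hC.1, y, hyC, hy⟩
        · exact Or.inr ⟨hC.1, y, hyC, hy⟩
      · intro x hx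
        have hxN : x ∉ N := fun h => hN ⟨x, h⟩
        simp only [N, mem_ofPred_eq, not_forall, not_infinite] at hxN
        obtain ⟨U, hU, hfin⟩ := hxN
        exact ⟨U, mem_nhdsWithin_of_mem_nhds hU, hfin⟩
    refine hinf (key.subset fun C hC => ⟨hC, ?_⟩)
    obtain ⟨y, hy⟩ := hC.1.1.prop.nonempty
    exact ⟨y, hy, hC.2 hy⟩
  have hNF : FlowInvariant F N := by
    intro i t ht x hx U hU
    refine (hx _ ((continuous_flow (hF i) (hb i) ht).continuousAt hU)).mono ?_
    rintro C ⟨hC, y, hyC, hyU⟩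
    exact ⟨hC, _, (hC.1.positivelyInvariant (hcl C hC)).flowInvariant hF hb i t ht y hyC, hyU⟩
  obtain ⟨K, hKN, hK⟩ := exists_isInvariantControlSet_subset hF hb
    (hMc.of_isClosed_subset hNc hNM) hNne hNF
  have hK𝒞 : K ∈ 𝒞 := ⟨hK, hKN.trans hNM⟩
  obtain ⟨y, hy⟩ := hint K hK𝒞
  refine hKN (interior_subset hy) (interior K) (isOpen_interior.mem_nhds hy)
    ((finite_singleton K).subset ?_)
  rintro C ⟨hC, hCK⟩
  exact hC.1.eq_of_inter_nonempty hK (hcl C hC) (hcl K hK𝒞)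
    (hCK.mono (inter_subset_inter_right _ interior_subset))

theorem LocallyAccessibleOn.finitelyManyRegularInvariantControlSets
    (hF : ∀ i, ContDiff ℝ ∞ (F i)) (hb : ∀ i, ∃ K : ℝ, ∀ x, ‖F i x‖ ≤ K) {M : Set (Space d)}
    (hMc : IsCompact M) (hacc : LocallyAccessibleOn F M) :
    FinitelyManyRegularInvariantControlSets F M := by
  have hcl : ∀ C ∈ invariantControlSets F M, IsClosed C := fun C hC =>
    hacc.isClosed_of_mem hF hb hMc.isClosed hC
  have hreach : ∀ C ∈ invariantControlSets F M, ∀ x ∈ C, reach F x ⊆ C := fun C hC x hx =>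
    (hC.1.positivelyInvariant (hcl C hC)).reach_subset hx
  have hreg : ∀ C ∈ invariantControlSets F M, C = closure (interior C) := by
    refine fun C hC => Subset.antisymm (fun x hx => ?_)
      (closure_minimal interior_subset (hcl C hC))
    refine mem_closure_iff_nhds.2 fun U hU => ?_
    rw [inter_comm]
    exact (hacc.nonempty_interior_reach_inter (hC.2 hx) hU).mono
      (inter_subset_inter_left _ (interior_mono (hreach C hC x hx)))
  refine ⟨finite_invariantControlSets hF hb hMc hcl fun C hC => ?_, fun C hC =>
    ⟨hreg C hC, fun x hx y hy => ?_⟩⟩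
  · have := hC.1.1.prop.nonempty
    rw [hreg C hC] at this
    exact closure_nonempty_iff.1 this
  · -- near `y`, an open set of points is controllable to `y`; it lies in the closure of the
    -- reachable set of `x`
    obtain ⟨z, hz, hzC⟩ := (hacc y (hC.2 (interior_subset hy)) 1 one_pos _
      (isOpen_interior.mem_nhds hy)).2
    obtain ⟨w, hw, hwx⟩ := mem_closure_iff.1
      (hC.1.1.prop.subset_closure_reach x hx (interior_subset hzC)) _ isOpen_interior hz
    have hwy : w ∈ controllableLE F 1 y := interior_subset hw
    exact mem_reach_trans hF hb hwx (reachLE_subset_reach 1 w hwy)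

/-! ### Transition probabilities of the chain -/

lemma ae_nonneg_expMeasure (lam : ℝ) : ∀ᵐ u ∂(expMeasure lam), 0 ≤ u := by
  have h : {u : ℝ | ¬ 0 ≤ u} = Iio 0 := by ext; simp
  rw [ae_iff, h, expMeasure, gammaMeasure, withDensity_apply _ measurableSet_Iio]
  exact lintegral_exponentialPDF_of_nonpos le_rfl

lemma expMeasure_Ioo_pos (hlam : 0 < lam) {a b : ℝ} (ha : 0 ≤ a) (hab : a < b) :
    0 < expMeasure lam (Ioo a b) := by
  rw [expMeasure, gammaMeasure, withDensity_apply _ measurableSet_Ioo,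
    setLIntegral_pos_iff (f := gammaPDF 1 lam) (measurable_gammaPDFReal 1 lam).ennreal_ofReal]
  have hsub : Ioo a b ⊆ Function.support (gammaPDF 1 lam) ∩ Ioo a b := fun u hu =>
    ⟨(ENNReal.ofReal_pos.2 (gammaPDFReal_pos one_pos hlam (ha.trans_lt hu.1))).ne', hu⟩
  exact (by simp [hab] : 0 < volume (Ioo a b)).trans_le (measure_mono hsub)

lemma transitionProb_mono (z : Space d × Fin (m + 1)) {A B : Set (Space d × Fin (m + 1))}
    (h : A ⊆ B) : transitionProb F Q lam z A ≤ transitionProb F Q lam z B :=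
  lintegral_mono fun _ => Finset.sum_le_sum fun _ _ => mul_le_mul_right
    (indicator_le_indicator_of_subset h (fun _ => zero_le) _) _

lemma transitionProb_eq_one (hQ_nonneg : ∀ x i j, 0 ≤ Q x i j) (hQ_sum : ∀ x i, ∑ j, Q x i j = 1)
    (hlam : 0 < lam) {z : Space d × Fin (m + 1)} {A : Set (Space d × Fin (m + 1))}
    (hA : ∀ u, 0 ≤ u → ∀ j, (flow (F z.2) u z.1, j) ∈ A) : transitionProb F Q lam z A = 1 := by
  have := isProbabilityMeasure_expMeasure hlam
  have h : ∀ᵐ u ∂(expMeasure lam), ∑ j, ENNReal.ofReal (Q (flow (F z.2) u z.1) z.2 j) *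
      A.indicator 1 (flow (F z.2) u z.1, j) = 1 := by
    filter_upwards [ae_nonneg_expMeasure lam] with u hu
    simp only [indicator_of_mem (hA u hu _), Pi.one_apply, mul_one]
    rw [← ENNReal.ofReal_sum_of_nonneg fun j _ => hQ_nonneg _ _ j, hQ_sum, ENNReal.ofReal_one]
  rw [transitionProb, lintegral_congr_ae h, lintegral_one, measure_univ]

/-- If following the current mode for a time `t` and then jumping to mode `j` is possible from `z`
and leads into the open set `O`, then the chain enters `O` with a probability that is bounded below
near `z`. -/
lemma exists_eventually_le_transitionProb (hF : ∀ i, ContDiff ℝ ∞ (F i))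
    (hb : ∀ i, ∃ K : ℝ, ∀ x, ‖F i x‖ ≤ K) (hQ : Continuous Q) (hlam : 0 < lam)
    {z : Space d × Fin (m + 1)} {O : Set (Space d × Fin (m + 1))} (hO : IsOpen O) {t : ℝ}
    (ht : 0 ≤ t) {j : Fin (m + 1)} (hQpos : 0 < Q (flow (F z.2) t z.1) z.2 j)
    (hmem : (flow (F z.2) t z.1, j) ∈ O) :
    ∃ c : ℝ≥0∞, c ≠ 0 ∧ ∀ᶠ w in 𝓝 z, c ≤ transitionProb F Q lam w O := by
  obtain ⟨x, i⟩ := z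
  simp only at hQpos hmem
  set q := Q (flow (F i) t x) i j
  have hflow : Filter.Tendsto (fun p : Space d × ℝ => flow (F i) p.2 p.1)
      (𝓝 x ×ˢ 𝓝[Ici 0] t) (𝓝 (flow (F i) t x)) := by
    have := continuousOn_flow (hF i) (hb i) (x, t) ⟨mem_univ _, ht⟩
    rwa [ContinuousWithinAt, nhdsWithin_prod_eq, nhdsWithin_univ] at this
  have hQij : Continuous fun y => Q y i j := by fun_prop
  have hev : ∀ᶠ y in 𝓝 (flow (F i) t x), q / 2 < Q y i j ∧ (y, j) ∈ O :=
    (hQij.continuousAt.eventually_const_lt (half_lt_self hQpos)).and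
      ((hO.preimage (Continuous.prodMk_left j)).mem_nhds hmem)
  obtain ⟨p, hp, r, hr, hpr⟩ := Filter.eventually_prod_iff.1 (hflow.eventually hev)
  obtain ⟨b, htb, hsub⟩ := mem_nhdsGT_iff_exists_Ioo_subset.1
    (nhdsWithin_mono t (Ioi_subset_Ici_self.trans (Ici_subset_Ici.2 ht)) hr)
  refine ⟨ENNReal.ofReal (q / 2) * expMeasure lam (Ioo t b), mul_ne_zero
    (ENNReal.ofReal_pos.2 (half_pos hQpos)).ne' (expMeasure_Ioo_pos hlam ht htb).ne', ?_⟩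
  have hi : ∀ᶠ k in 𝓝 i, k = i := by simp [nhds_discrete]
  filter_upwards [continuous_fst.continuousAt.eventually hp,
    continuous_snd.continuousAt.eventually hi] with ⟨y, k⟩ hy hk
  simp only at hy hk
  subst hk
  rw [← setLIntegral_const]
  refine (setLIntegral_mono' measurableSet_Ioo fun u hu => ?_).trans (setLIntegral_le_lintegral _ _)
  have h := hpr hy (hsub hu)
  refine le_trans ?_ (Finset.single_le_sum (fun _ _ => zero_le) (Finset.mem_univ j))
  simp only [indicator_of_mem h.2, Pi.one_apply, mul_one]
  exact ENNReal.ofReal_le_ofReal h.1.le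

/-- A property that passes along the positive entries of a nonnegative matrix also passes along
the positive entries of its powers. -/
lemma of_pow_pos_of_step {n : Type*} [Fintype n] [DecidableEq n] {P : Matrix n n ℝ}
    (hP : ∀ i j, 0 ≤ P i j) {p : n → Prop} (hp : ∀ i j, p i → 0 < P i j → p j) {i : n} (hi : p i)
    (k : ℕ) : ∀ j, 0 < (P ^ k) i j → p j := by
  induction k with
  | zero =>
    intro j hj
    rw [pow_zero, Matrix.one_apply] at hj
    split_ifs at hj with h
    · exact h ▸ hi
    · exact absurd hj (lt_irrefl _)
  | succ k ih =>
    intro j hj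
    rw [pow_succ, Matrix.mul_apply] at hj
    obtain ⟨l, -, hl⟩ := Finset.exists_lt_of_sum_lt (s := Finset.univ) (f := fun _ : n => (0 : ℝ))
      (by simpa using hj)
    have hPl : 0 < P l j := (hP l j).lt_of_ne fun h => by simp [← h] at hl
    exact hp l j (ih l (pos_of_mul_pos_left hl hPl.le)) hPl

/-! ### Supports of invariant measures -/

/-- Mass balance for an absorbing set `A`: if `μ` does not charge `O \ A`, then no mass outside `A`
can enter `A ∪ O` in one step, because all the mass of `A` stays there and
`μ (A ∪ O) = μ A`. A local lower bound for the probability of entering `O` makes this a statement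
about supports that needs no measurability of transition probabilities. -/
lemma IsInvariantMeasure.notMem_support_restrict_compl {M : Set (Space d)}
    {μ : Measure (Space d × Fin (m + 1))} (hμ : IsInvariantMeasure F Q lam M μ)
    {A O : Set (Space d × Fin (m + 1))} (hA : MeasurableSet A)
    (habs : ∀ z ∈ A, transitionProb F Q lam z A = 1) (hO : IsOpen O) (hO0 : μ.restrict Aᶜ O = 0)
    {z : Space d × Fin (m + 1)} {c : ℝ≥0∞} (hc : c ≠ 0)
    (hz : ∀ᶠ w in 𝓝 z, c ≤ transitionProb F Q lam w O) : z ∉ (μ.restrict Aᶜ).support := by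
  have := hμ.isProbabilityMeasure
  obtain ⟨U, hU, hUo, hzU⟩ := eventually_nhds_iff.1 hz
  have hOm := hO.measurableSet
  have hUm := hUo.measurableSet
  rw [Measure.restrict_apply hOm] at hO0
  refine Measure.notMem_support_iff_exists.2 ⟨U, hUo.mem_nhds hzU, ?_⟩
  rw [Measure.restrict_apply hUm]
  have h1 : μ (A ∪ O) ≤ μ A :=
    calc μ (A ∪ O) = μ (A ∪ O ∩ Aᶜ) := by rw [← sdiff_eq, union_sdiff_self]
      _ ≤ μ A + μ (O ∩ Aᶜ) := measure_union_le _ _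
      _ = μ A := by rw [hO0, add_zero]
  have h2 : μ A + c * μ (U ∩ Aᶜ) ≤ μ (A ∪ O) := by
    rw [hμ.invariant _ (hA.union hOm), ← lintegral_indicator_one hA,
      ← lintegral_indicator_const (hUm.inter hA.compl),
      ← lintegral_add_left (measurable_one.indicator hA)]
    refine lintegral_mono fun w => ?_
    by_cases hw : w ∈ A
    · have : w ∉ U ∩ Aᶜ := fun h => h.2 hw
      simp only [indicator_of_mem hw, indicator_of_notMem this, add_zero, Pi.one_apply]
      rw [← habs w hw]
      exact transitionProb_mono w subset_union_left
    · rw [indicator_of_notMem hw, zero_add]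
      by_cases hwU : w ∈ U ∩ Aᶜ
      · rw [indicator_of_mem hwU]
        exact (hU w hwU.1).trans (transitionProb_mono w subset_union_right)
      · rw [indicator_of_notMem hwU]
        exact zero_le
  have h3 : c * μ (U ∩ Aᶜ) = 0 := by
    have h4 : μ A + c * μ (U ∩ Aᶜ) ≤ μ A + 0 := by simpa using h2.trans h1
    exact le_zero_iff.1 ((ENNReal.add_le_add_iff_left (measure_ne_top μ A)).1 h4)
  exact (mul_eq_zero.1 h3).resolve_left hc

/-- The part of `μ` outside the absorbing set `⋃ C × E` has a support that is closed under the
steps of the chain. The set of positions that occur in this support with all modes is thus closed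
and flow-invariant, and so it contains an invariant control set `C` unless it is empty; but
`int C × E` carries no mass outside `⋃ C × E`. -/
theorem IsInvariantMeasure.support_subset (hF : ∀ i, ContDiff ℝ ∞ (F i))
    (hb : ∀ i, ∃ K : ℝ, ∀ x, ‖F i x‖ ≤ K) (hQ_cont : Continuous Q)
    (hQ_nonneg : ∀ x i j, 0 ≤ Q x i j) (hQ_sum : ∀ x i, ∑ j, Q x i j = 1)
    (hQ_irred : ∀ x, ∃ n : ℕ, ∀ i j, 0 < (Q x ^ n) i j) (hlam : 0 < lam)
    {M : Set (Space d)} (hMc : IsCompact M) (hreg : FinitelyManyRegularInvariantControlSets F M)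
    {μ : Measure (Space d × Fin (m + 1))} (hμ : IsInvariantMeasure F Q lam M μ) :
    μ.support ⊆ ⋃ C ∈ invariantControlSets F M, C ×ˢ univ := by
  set A : Set (Space d × Fin (m + 1)) := ⋃ C ∈ invariantControlSets F M, C ×ˢ univ with hA
  have hcl : ∀ C ∈ invariantControlSets F M, IsClosed C := fun C hC => by
    rw [(hreg.2 C hC).1]; exact isClosed_closure
  have hAc : IsClosed A := hreg.1.isClosed_biUnion fun C hC => (hcl C hC).prod isClosed_univ
  have habs : ∀ z ∈ A, transitionProb F Q lam z A = 1 := by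
    intro z hz
    obtain ⟨C, hC, hzC⟩ := mem_iUnion₂.1 hz
    exact transitionProb_eq_one hQ_nonneg hQ_sum hlam fun u hu j => mem_iUnion₂.2 ⟨C, hC,
      (hC.1.positivelyInvariant (hcl C hC)).flowInvariant hF hb z.2 u hu z.1 hzC.1, mem_univ _⟩
  set N := (μ.restrict Aᶜ).support with hN
  have hstep : ∀ x i t j, 0 ≤ t → 0 < Q (flow (F i) t x) i j → (x, i) ∈ N →
      (flow (F i) t x, j) ∈ N := by
    intro x i t j ht hpos hmem
    by_contra hnot
    obtain ⟨c, hc, hev⟩ := exists_eventually_le_transitionProb (z := (x, i)) hF hb hQ_cont hlam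
      Measure.isOpen_compl_support ht hpos hnot
    exact hμ.notMem_support_restrict_compl hAc.measurableSet habs Measure.isOpen_compl_support
      Measure.measure_compl_support hc hev hmem
  have hmodes : ∀ x i, (x, i) ∈ N → ∀ j, (x, j) ∈ N := by
    intro x i hi j
    obtain ⟨n, hn⟩ := hQ_irred x
    refine of_pow_pos_of_step (hQ_nonneg x) (p := fun k => (x, k) ∈ N)
      (fun k l hk hkl => ?_) hi n j (hn i j)
    -- jumps without motion are the steps with waiting time `0`
    have h0 := (flow_spec (hF k) (hb k) x).1
    simpa [h0] using hstep x k 0 l le_rfl (by rwa [h0]) hk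
  let S : Set (Space d) := {x | ∀ j, (x, j) ∈ N}
  have hSc : IsClosed S := by
    simp only [S, ofPred_forall]
    exact isClosed_iInter fun j => Measure.isClosed_support.preimage (Continuous.prodMk_left j)
  have hSM : S ⊆ M := by
    have h : N ⊆ M ×ˢ univ := Measure.support_subset_of_isClosed (hMc.isClosed.prod isClosed_univ)
      (mem_ae_iff.2 (Measure.absolutelyContinuous_of_le Measure.restrict_le_self hμ.concentrated))
    exact fun x hx => (h (hx 0)).1
  have hSF : FlowInvariant F S := by
    intro i t ht x hx
    obtain ⟨j, -, hj⟩ := Finset.exists_lt_of_sum_lt (s := Finset.univ)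
      (f := fun _ : Fin (m + 1) => (0 : ℝ)) (g := Q (flow (F i) t x) i) (by simp [hQ_sum])
    exact hmodes _ j (hstep x i t j ht hj (hx i))
  have hNempty : N = ∅ := by
    by_contra hne
    obtain ⟨⟨x, i⟩, hxi⟩ := nonempty_iff_ne_empty.2 hne
    obtain ⟨C, hCS, hC⟩ := exists_isInvariantControlSet_subset hF hb
      (hMc.of_isClosed_subset hSc hSM) ⟨x, hmodes x i hxi⟩ hSF
    have hCM : C ∈ invariantControlSets F M := ⟨hC, hCS.trans hSM⟩
    have hCne := hC.1.prop.nonempty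
    rw [(hreg.2 C hCM).1] at hCne
    obtain ⟨y, hy⟩ := closure_nonempty_iff.1 hCne
    refine Measure.notMem_support_iff_exists.2 ⟨interior C ×ˢ univ,
      (isOpen_interior.prod isOpen_univ).mem_nhds ⟨hy, mem_univ _⟩, ?_⟩
      (hCS (interior_subset hy) 0)
    rw [Measure.restrict_apply (isOpen_interior.prod isOpen_univ).measurableSet]
    convert measure_empty (μ := μ) using 2
    refine disjoint_iff_inter_eq_empty.1 (disjoint_compl_right_iff_subset.2 ?_)
    exact fun z hz => mem_iUnion₂.2 ⟨C, hCM, interior_subset hz.1, mem_univ _⟩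
  refine Measure.support_subset_of_isClosed hAc (mem_ae_iff.2 ?_)
  rwa [hN, Measure.support_eq_empty_iff, Measure.restrict_eq_zero] at hNempty

end PDMP

theorem mainTheorem2 {d m : ℕ}
    (F : Fin (m + 1) → PDMP.Space d → PDMP.Space d)
    (hF_smooth : ∀ i, ContDiff ℝ ∞ (F i))
    (hF_bdd : ∀ i, ∃ K : ℝ, ∀ x, ‖F i x‖ ≤ K)
    (Q : PDMP.Space d → Matrix (Fin (m + 1)) (Fin (m + 1)) ℝ)
    (hQ_cont : Continuous Q)
    (hQ_nonneg : ∀ x i j, 0 ≤ Q x i j)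
    (hQ_sum : ∀ x i, ∑ j, Q x i j = 1)
    (hQ_irred : ∀ x, ∃ n : ℕ, ∀ i j, 0 < (Q x ^ n) i j)
    (lam : ℝ) (hlam : 0 < lam)
    (M : Set (PDMP.Space d)) (hM_compact : IsCompact M)
    (hM_inv : PDMP.PositivelyInvariant F M) :
    (PDMP.LocallyAccessibleOn F M → PDMP.FinitelyManyRegularInvariantControlSets F M) ∧
    (PDMP.FinitelyManyRegularInvariantControlSets F M →
      ∀ μ : Measure (PDMP.Space d × Fin (m + 1)),
        PDMP.IsInvariantMeasure F Q lam M μ →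
        μ.support ⊆ ⋃ C ∈ PDMP.invariantControlSets F M, C ×ˢ univ) := by
  exact ⟨fun hacc => hacc.finitelyManyRegularInvariantControlSets hF_smooth hF_bdd hM_compact,
    fun hreg _ hμ => hμ.support_subset hF_smooth hF_bdd hQ_cont hQ_nonneg hQ_sum hQ_irred hlam
      hM_compact hreg⟩
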